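/- Let $d,n$ be integers with $0<d<n$, and let $C_\mu,C_D>0$. There are constants $C>0$ and $C_0>1$, depending only on $n,d,C_\mu,C_D$, such that the following holds. Let $\mu$ be a Borel measure on $\mathbb{R}^n$ with support $E=\operatorname{spt}\mu$ that is $d$-Ahlfors regular with constant $C_\mu$, i.e. $C_\mu^{-1}r^d\le\mu(B(x,r))\le C_\mu r^d$ for all $x\in E$ and $r>0$, where $B(x,r)$ is the open ball. Let $\mathcal{H}^d$ be the $d$-dimensional Hausdorff measure, normalized so that unit balls of $d$-planes have measure $1$. Let $\Delta=\bigcup_{j\in\mathbb{Z}}\Delta_j$ be a system of dyadic cubes for $E$ with constant $C_D$: each $\Delta_j$ is a partition of $E$ into nonempty sets; if $j\le k$, $Q\in\Delta_j$ and $Q'\in\Delta_k$, then $Q\cap Q'=\emptyset$ or $Q\subset Q'$; and every $Q\in\Delta_j$ satisfies $$C_D^{-1}2^j\le\operatorname{diam}Q\le C_D2^j,\qquad C_D^{-1}2^{jd}\le\mathcal{H}^d(Q)\le C_D2^{jd},$$ $$\mathcal{H}^d(\{x\in Q:\operatorname{dist}(x,E\setminus Q)\le\tau2^j\})\le C_D\tau^{1/C_D}2^{jd}\quad\text{for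 all }\tau>0.$$ For each $Q\in\Delta$ let a point $c_Q\in Q$ (the center of $Q$) be chosen arbitrarily. For $R\in\Delta$ let $\Delta(R)=\{Q\in\Delta:Q\subset R\}$, and for $\lambda>1$ let $\lambda R=\{x\in E:\operatorname{dist}(x,R)\le(\lambda-1)\operatorname{diam}R\}$. For $g\in L^2_{\mathrm{loc}}(\mu)$ (real-valued) and $Q\in\Delta$ put $$\mathcal{O}_{\mu,g}(Q)=(\operatorname{diam}Q)^{-d-1}\inf_{\lambda\in\mathbb{R}}\ \sup_{f}\ \left|\int (fg-\lambda f)\,d\mu\right|,$$ where the supremum is over all $1$-Lipschitz $f:\mathbb{R}^n\to\mathbb{R}$ with compact support contained in $B(c_Q,3\operatorname{diam}Q)$. Then for every $g\in L^2_{\mathrm{loc}}(\mu)$ and every $R_0\in\Delta$, $$\frac1{\mu(R_0)}\sum_{Q\in\Delta(R_0)}\mathcal{O}_{\mu,g}(Q)^2\mu(Q)\ \le\ C\,\frac{1}{\mu(C_0R_0)}\int_{C_0R_0}\left|g-(g)_{C_0R_0}\right|^2d\mu,\qquad (g)_A=\frac1{\mu(A)}\int_A g\,d\mu.$$ -/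

import Mathlib

open MeasureTheory Metric
open scoped ENNReal

/-- `d`-dimensional Hausdorff measure on `ℝⁿ`, normalized so that the `d`-dimensional unit ball in a
`d`-plane has measure `1` (`μHE[d]` is Hausdorff measure normalized to agree with Lebesgue measure
on `d`-planes). -/
noncomputable def normHausdorff {n : ℕ} (d : ℕ) : Measure (EuclideanSpace ℝ (Fin n)) :=
  (volume (ball (0 : EuclideanSpace ℝ (Fin d)) 1))⁻¹ • μHE[d]

/-- `μ` is `d`-Ahlfors regular with constant `C`. -/
def IsAhlforsRegular {n : ℕ} (d : ℕ) (C : ℝ) (μ : Measure (EuclideanSpace ℝ (Fin n))) : Prop :=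
  ∀ x ∈ μ.support, ∀ r : ℝ, 0 < r →
    ENNReal.ofReal (C⁻¹ * r ^ d) ≤ μ (ball x r) ∧ μ (ball x r) ≤ ENNReal.ofReal (C * r ^ d)

/-- `Δ` (with `Δ j` the family of cubes of generation `j`, of size about `2 ^ j`) is a system of
(Christ–David) dyadic cubes for the set `E`, with constant `C`. -/
structure IsDyadicSystem {n : ℕ} (d : ℕ) (E : Set (EuclideanSpace ℝ (Fin n))) (C : ℝ)
    (Δ : ℤ → Set (Set (EuclideanSpace ℝ (Fin n)))) : Prop where
  /-- each generation is a partition of `E` into nonempty sets -/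
  nonempty : ∀ j, ∀ Q ∈ Δ j, Q.Nonempty
  sUnion_eq : ∀ j, ⋃₀ Δ j = E
  disjoint : ∀ j, (Δ j).PairwiseDisjoint id
  /-- nestedness -/
  nested : ∀ j k, j ≤ k → ∀ Q ∈ Δ j, ∀ Q' ∈ Δ k, Q ∩ Q' = ∅ ∨ Q ⊆ Q'
  /-- size; the lower bound on `ediam` and finiteness of the upper bound make `diam` meaningful -/
  ediam_ge : ∀ j, ∀ Q ∈ Δ j, ENNReal.ofReal (C⁻¹ * (2 : ℝ) ^ j) ≤ ediam Q
  ediam_le : ∀ j, ∀ Q ∈ Δ j, ediam Q ≤ ENNReal.ofReal (C * (2 : ℝ) ^ j)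
  measure_ge : ∀ j, ∀ Q ∈ Δ j, ENNReal.ofReal (C⁻¹ * (2 : ℝ) ^ (j * d)) ≤ normHausdorff d Q
  measure_le : ∀ j, ∀ Q ∈ Δ j, normHausdorff d Q ≤ ENNReal.ofReal (C * (2 : ℝ) ^ (j * d))
  /-- small boundaries (the distance to the empty set is `∞`) -/
  boundary_le : ∀ j, ∀ Q ∈ Δ j, ∀ τ : ℝ, 0 < τ →
    normHausdorff d {x ∈ Q | infEDist x (E \ Q) ≤ ENNReal.ofReal (τ * (2 : ℝ) ^ j)}
      ≤ ENNReal.ofReal (C * τ ^ (1 / C) * (2 : ℝ) ^ (j * d))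

/-- The set of all cubes of a dyadic system. -/
def allCubes {n : ℕ} (Δ : ℤ → Set (Set (EuclideanSpace ℝ (Fin n)))) :
    Set (Set (EuclideanSpace ℝ (Fin n))) :=
  ⋃ j, Δ j

/-- `Δ(R)`: the cubes of a dyadic system that are contained in `R`. -/
def cubesIn {n : ℕ} (Δ : ℤ → Set (Set (EuclideanSpace ℝ (Fin n))))
    (R : Set (EuclideanSpace ℝ (Fin n))) : Set (Set (EuclideanSpace ℝ (Fin n))) :=
  {Q | Q ∈ allCubes Δ ∧ Q ⊆ R}

/-- The dilate `lam Q = {x ∈ E : dist(x, Q) ≤ (lam - 1) diam Q}` for `lam > 1`. -/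
def dilate {n : ℕ} (E : Set (EuclideanSpace ℝ (Fin n))) (lam : ℝ)
    (Q : Set (EuclideanSpace ℝ (Fin n))) : Set (EuclideanSpace ℝ (Fin n)) :=
  {x ∈ E | infDist x Q ≤ (lam - 1) * diam Q}

/-- `Λ(Ω)`: the `1`-Lipschitz functions on `ℝⁿ` with compact support contained in `Ω`. -/
def lipTest {n : ℕ} (Ω : Set (EuclideanSpace ℝ (Fin n))) : Set (EuclideanSpace ℝ (Fin n) → ℝ) :=
  {f | LipschitzWith 1 f ∧ HasCompactSupport f ∧ tsupport f ⊆ Ω}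

/-- The oscillation coefficient `O_{μ,g}(Q)`, where `Q` has center `c`, so that
`3 B_Q = B(c, 3 diam Q)`. -/
noncomputable def oscCoeff {n : ℕ} (d : ℕ) (μ : Measure (EuclideanSpace ℝ (Fin n)))
    (g : EuclideanSpace ℝ (Fin n) → ℝ) (Q : Set (EuclideanSpace ℝ (Fin n)))
    (c : EuclideanSpace ℝ (Fin n)) : ℝ≥0∞ :=
  (ENNReal.ofReal (diam Q ^ (d + 1)))⁻¹ *
    ⨅ lam : ℝ, ⨆ f ∈ lipTest (ball c (3 * diam Q)),
      ENNReal.ofReal |∫ x, (f x * g x - lam * f x) ∂μ|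

/-- `g ∈ L²_loc(μ)`. -/
def IsL2Loc {n : ℕ} (μ : Measure (EuclideanSpace ℝ (Fin n)))
    (g : EuclideanSpace ℝ (Fin n) → ℝ) : Prop :=
  ∀ K : Set (EuclideanSpace ℝ (Fin n)), IsCompact K → MemLp g 2 (μ.restrict K)

/-! The sum is controlled by almost orthogonality. Subtracting a multiple of a tent function at `c
Q` turns each test function into a Lipschitz bump of mean zero, and the matching multiple of `g` is
a single `lam` serving all test functions (`exists_multiplier_of_lipTest`). Hence each coefficient
is, up to a factor, a pairing of `g` with one mean-zero bump (`exists_bump_oscCoeff_le`).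

Two bumps have disjoint supports when their centers are far apart. Otherwise, cancellation of the
smaller one against the Lipschitz continuity of the larger gives an inner product at most a constant
times `m ^ (d + 2)`, with `m` the smaller scale. Ahlfors regularity and the small boundary condition
bound the number of nearby cubes of each generation (`IsDyadicSystem.card_le`), so the Gram matrix
passes a weighted Schur test and a Bessel inequality follows (`sum_integral_bump_sq_le`).

On the support of `μ` all bumps live in `4R`, and having mean zero they do not see constants, so `g`
may be replaced by `g - m` cut off to `4R`. This gives the mean oscillation on the right. -/

/-! ### Abstract almost orthogonality. -/

open scoped RealInnerProductSpace in
/-- Weighted Schur test: almost orthogonality of a finite family gives a Bessel inequality. -/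
theorem sum_mul_inner_sq_le_of_schur {H ι : Type*} [NormedAddCommGroup H] [InnerProductSpace ℝ H]
    (S : Finset ι) (h : ι → H) (w b : ι → ℝ) (hw : ∀ i ∈ S, 0 ≤ w i) (hb : ∀ i ∈ S, 0 < b i)
    {A : ℝ} (hA : 0 < A)
    (hS : ∀ i ∈ S, ∑ j ∈ S, w j * |⟪h i, h j⟫| * b j ≤ A * b i) (g : H) :
    ∑ i ∈ S, w i * ⟪h i, g⟫ ^ 2 ≤ A * ‖g‖ ^ 2 := by
  set a : ι → ℝ := fun i => ⟪h i, g⟫ with ha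
  set v : H := ∑ i ∈ S, (w i * a i) • h i with hv
  set T : ℝ := ∑ i ∈ S, w i * a i ^ 2 with hT
  have hvg : ⟪g, v⟫ = T := by
    rw [hv, inner_sum, hT]
    refine Finset.sum_congr rfl fun i _ => ?_
    rw [inner_smul_right, real_inner_comm]
    simp only [ha]; ring
  have hvv : ‖v‖ ^ 2 ≤ A * T := by
    have e1 : ‖v‖ ^ 2 = ∑ i ∈ S, ∑ j ∈ S, w i * a i * (w j * a j * ⟪h i, h j⟫) := by
      rw [← real_inner_self_eq_norm_sq, hv, sum_inner]
      refine Finset.sum_congr rfl fun i _ => ?_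
      rw [inner_smul_left, inner_sum, Finset.mul_sum]
      refine Finset.sum_congr rfl fun j _ => ?_
      rw [inner_smul_right]; rfl
    -- The arithmetic-geometric mean inequality, weighted by `b`, splits each Gram term into two
    -- transposed halves. Summing `F i j` over `j` is exactly what the Schur hypothesis controls.
    set F : ι → ι → ℝ := fun i j => w i * a i ^ 2 / b i * (w j * |⟪h i, h j⟫| * b j) with hF
    have e2 : ∀ i ∈ S, ∀ j ∈ S,
        w i * a i * (w j * a j * ⟪h i, h j⟫) ≤ (F i j + F j i) / 2 := by
      intro i hi j hj
      have hbi := hb i hi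
      have hbj := hb j hj
      have k0 : a i * a j * ⟪h i, h j⟫ ≤ |a i| * |a j| * |⟪h i, h j⟫| := by
        rw [← abs_mul, ← abs_mul]; exact le_abs_self _
      have k1 : |a i| * |a j| ≤ (a i ^ 2 / b i * b j + a j ^ 2 / b j * b i) / 2 := by
        have : 0 ≤ (|a i| * b j - |a j| * b i) ^ 2 / (b i * b j) := by positivity
        have e : (|a i| * b j - |a j| * b i) ^ 2 / (b i * b j) =
            a i ^ 2 / b i * b j + a j ^ 2 / b j * b i - 2 * (|a i| * |a j|) := by
          rw [← sq_abs (a i), ← sq_abs (a j)]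
          field_simp
          ring
        linarith
      have hww : 0 ≤ w i * w j := mul_nonneg (hw i hi) (hw j hj)
      calc w i * a i * (w j * a j * ⟪h i, h j⟫)
          = w i * w j * (a i * a j * ⟪h i, h j⟫) := by ring
        _ ≤ w i * w j * ((a i ^ 2 / b i * b j + a j ^ 2 / b j * b i) / 2 * |⟪h i, h j⟫|) := by
          refine mul_le_mul_of_nonneg_left (k0.trans ?_) hww
          exact mul_le_mul_of_nonneg_right k1 (abs_nonneg _)
        _ = (F i j + F j i) / 2 := by
          simp only [hF]; rw [real_inner_comm (h i) (h j)]; ring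
    have e3 : ∑ i ∈ S, ∑ j ∈ S, F i j ≤ A * T := by
      rw [hT, Finset.mul_sum]
      refine Finset.sum_le_sum fun i hi => ?_
      have hbi := hb i hi
      have hwi := hw i hi
      rw [← Finset.mul_sum]
      calc _ ≤ w i * a i ^ 2 / b i * (A * b i) :=
            mul_le_mul_of_nonneg_left (hS i hi) (by positivity)
        _ = A * (w i * a i ^ 2) := by field_simp
    calc ‖v‖ ^ 2 ≤ ∑ i ∈ S, ∑ j ∈ S, (F i j + F j i) / 2 := by
          rw [e1]
          exact Finset.sum_le_sum fun i hi => Finset.sum_le_sum fun j hj => e2 i hi j hj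
      _ = ∑ i ∈ S, ∑ j ∈ S, F i j := by
          simp only [add_div, Finset.sum_add_distrib]
          rw [Finset.sum_comm (f := fun i j => F j i / 2), ← Finset.sum_add_distrib]
          refine Finset.sum_congr rfl fun i _ => ?_
          rw [← Finset.sum_add_distrib]
          exact Finset.sum_congr rfl fun j _ => by ring
      _ ≤ A * T := e3
  -- Expanding gives `0 ≤ A² ‖g‖² - 2 A T + ‖v‖²`, and `‖v‖² ≤ A T` absorbs one of the two copies of
  -- `A T`.
  have h0 : 0 ≤ ‖A • g - v‖ ^ 2 := by positivity
  rw [norm_sub_sq_real, inner_smul_left, hvg, norm_smul, Real.norm_of_nonneg hA.le, mul_pow] at h0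
  simp only [conj_trivial] at h0
  have : 0 ≤ A * (A * ‖g‖ ^ 2 - T) := by nlinarith
  have := nonneg_of_mul_nonneg_right this hA
  linarith

/-- On each side of `i` the exponents are distinct, so each side is dominated by a geometric series
of sum 2. -/
theorem sum_half_pow_natAbs_sub_le (T : Finset ℤ) (i : ℤ) :
    ∑ k ∈ T, (1 / 2 : ℝ) ^ (i - k).natAbs ≤ 4 := by
  have key : ∀ U : Finset ℤ, Set.InjOn (fun k => (i - k).natAbs) U →
      ∑ k ∈ U, (1 / 2 : ℝ) ^ (i - k).natAbs ≤ 2 := by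
    intro U hU
    rw [← Finset.sum_image (f := fun m : ℕ => (1 / 2 : ℝ) ^ m) hU]
    exact (summable_geometric_two.sum_le_tsum _ fun _ _ => by positivity).trans
      tsum_geometric_two.le
  rw [← Finset.sum_filter_add_sum_filter_not T (fun k => k ≤ i)]
  have h1 := key (T.filter fun k => k ≤ i) (by
    intro x hx y hy hxy; simp at hx hy hxy; omega)
  have h2 := key (T.filter fun k => ¬ k ≤ i) (by
    intro x hx y hy hxy; simp at hx hy hxy; omega)
  linarith

/-! ### Lipschitz bumps of mean zero. -/

/-- `h` is `L`-Lipschitz, vanishes off `B(c, 3D)` and has mean zero. -/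
structure IsMeanZeroBump {n : ℕ} (μ : Measure (EuclideanSpace ℝ (Fin n))) (L : ℝ)
    (c : EuclideanSpace ℝ (Fin n)) (D : ℝ) (h : EuclideanSpace ℝ (Fin n) → ℝ) : Prop where
  lip : ∀ x y, |h x - h y| ≤ L * dist x y
  zero : ∀ x ∉ ball c (3 * D), h x = 0
  mean : ∫ x, h x ∂μ = 0

theorem continuous_of_abs_sub_le {X : Type*} [PseudoMetricSpace X] {L : ℝ} {h : X → ℝ}
    (lip : ∀ x y, |h x - h y| ≤ L * dist x y) : Continuous h := by
  refine (LipschitzWith.of_dist_le_mul (K := L.toNNReal) fun x y => ?_).continuous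
  rw [Real.dist_eq]
  exact (lip x y).trans (mul_le_mul_of_nonneg_right (Real.le_coe_toNNReal L) dist_nonneg)

theorem hasCompactSupport_of_eq_zero_off_ball {X : Type*} [PseudoMetricSpace X] [ProperSpace X]
    {c : X} {r : ℝ} {h : X → ℝ} (hz : ∀ x ∉ ball c r, h x = 0) : HasCompactSupport h :=
  HasCompactSupport.intro (isCompact_closedBall c r) fun x hx =>
    hz x fun h' => hx (ball_subset_closedBall h')

/-- Compare with a zero of `h` on the bounding sphere, at distance at most `6D`; `0 < n` ensures
that the sphere is nonempty. -/
theorem abs_le_of_lip_of_eq_zero_off_ball {n : ℕ} (hn : 0 < n) {L D : ℝ} (hL : 0 ≤ L)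
    (hD : 0 ≤ D) {c : EuclideanSpace ℝ (Fin n)} {h : EuclideanSpace ℝ (Fin n) → ℝ}
    (lip : ∀ x y, |h x - h y| ≤ L * dist x y) (hz : ∀ x ∉ ball c (3 * D), h x = 0)
    (x : EuclideanSpace ℝ (Fin n)) : |h x| ≤ 6 * L * D := by
  by_cases hx : x ∈ ball c (3 * D)
  · have : Nonempty (Fin n) := ⟨⟨0, hn⟩⟩
    obtain ⟨y, hy⟩ : (sphere c (3 * D)).Nonempty :=
      NormedSpace.sphere_nonempty.2 (by positivity)
    have hy' : dist y c = 3 * D := hy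
    have h0 : h y = 0 := hz y (by simp [hy'])
    have h1 := lip x y
    rw [h0, sub_zero] at h1
    have h2 : dist x y ≤ 6 * D := by
      have := dist_triangle_right x y c
      have hx' : dist x c < 3 * D := hx
      linarith
    calc |h x| ≤ L * dist x y := h1
      _ ≤ L * (6 * D) := mul_le_mul_of_nonneg_left h2 hL
      _ = 6 * L * D := by ring
  · rw [hz x hx, abs_zero]; positivity

section
variable {n : ℕ} {μ : Measure (EuclideanSpace ℝ (Fin n))} {L D : ℝ}
  {c : EuclideanSpace ℝ (Fin n)} {h : EuclideanSpace ℝ (Fin n) → ℝ}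

theorem IsMeanZeroBump.continuous (hh : IsMeanZeroBump μ L c D h) : Continuous h :=
  continuous_of_abs_sub_le hh.lip

theorem IsMeanZeroBump.hasCompactSupport (hh : IsMeanZeroBump μ L c D h) : HasCompactSupport h :=
  hasCompactSupport_of_eq_zero_off_ball hh.zero

theorem IsMeanZeroBump.integrable [IsFiniteMeasureOnCompacts μ] (hh : IsMeanZeroBump μ L c D h) :
    Integrable h μ :=
  hh.continuous.integrable_of_hasCompactSupport hh.hasCompactSupport

theorem IsMeanZeroBump.memLp [IsFiniteMeasureOnCompacts μ] (hh : IsMeanZeroBump μ L c D h) :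
    MemLp h 2 μ :=
  hh.continuous.memLp_of_hasCompactSupport hh.hasCompactSupport

/-- Mean-zero bumps are almost orthogonal. -/
theorem IsMeanZeroBump.abs_integral_mul_le [IsFiniteMeasureOnCompacts μ] (hn : 0 < n)
    (hL : 0 ≤ L) (hD : 0 ≤ D) {c' : EuclideanSpace ℝ (Fin n)} {D' : ℝ}
    {h' : EuclideanSpace ℝ (Fin n) → ℝ}
    (hh : IsMeanZeroBump μ L c D h) (hh' : IsMeanZeroBump μ L c' D' h') :
    |∫ x, h x * h' x ∂μ| ≤ 18 * L ^ 2 * D ^ 2 * μ.real (ball c (3 * D)) := by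
  -- The mean-zero property of `h` permits subtracting the value of `h'` at the center of `h`. The
  -- resulting bound involves only the scale `D`, so it can be applied with the smaller bump in the
  -- role of `h`.
  have e1 : ∫ x, h x * h' x ∂μ = ∫ x, h x * (h' x - h' c) ∂μ := by
    have i1 : Integrable (fun x => h x * h' x) μ :=
      (hh.continuous.mul hh'.continuous).integrable_of_hasCompactSupport
        hh.hasCompactSupport.mul_right
    have i2 : Integrable (fun x => h x * h' c) μ := hh.integrable.mul_const _
    simp only [mul_sub]
    rw [integral_sub i1 i2, integral_mul_const, hh.mean]
    ring
  have e2 : ∫ x, h x * (h' x - h' c) ∂μ = ∫ x in ball c (3 * D), h x * (h' x - h' c) ∂μ := by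
    rw [setIntegral_eq_integral_of_forall_compl_eq_zero]
    intro x hx
    rw [hh.zero x hx, zero_mul]
  rw [e1, e2, ← Real.norm_eq_abs]
  refine norm_setIntegral_le_of_norm_le_const measure_ball_lt_top fun x hx => ?_
  rw [Real.norm_eq_abs, abs_mul]
  have b1 := abs_le_of_lip_of_eq_zero_off_ball hn hL hD hh.lip hh.zero x
  have b2 : |h' x - h' c| ≤ L * (3 * D) :=
    (hh'.lip x c).trans (mul_le_mul_of_nonneg_left (le_of_lt hx) hL)
  calc |h x| * |h' x - h' c| ≤ (6 * L * D) * (L * (3 * D)) :=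
        mul_le_mul b1 b2 (abs_nonneg _) (by positivity)
    _ = 18 * L ^ 2 * D ^ 2 := by ring

theorem IsMeanZeroBump.integral_mul_eq_zero {c' : EuclideanSpace ℝ (Fin n)} {D' : ℝ}
    {h' : EuclideanSpace ℝ (Fin n) → ℝ}
    (hh : IsMeanZeroBump μ L c D h) (hh' : IsMeanZeroBump μ L c' D' h')
    (hdist : 3 * D + 3 * D' ≤ dist c c') : ∫ x, h x * h' x ∂μ = 0 := by
  refine integral_eq_zero_of_ae (Filter.Eventually.of_forall fun x => ?_)
  by_cases hx : x ∈ ball c (3 * D)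
  · have : x ∉ ball c' (3 * D') := fun hx' =>
      Set.disjoint_left.1 (ball_disjoint_ball hdist) hx hx'
    simp [hh'.zero x this]
  · simp [hh.zero x hx]

/-! ### The Bessel inequality across scales. -/

/-- A Bessel inequality for mean-zero bumps at dyadic scales whose centers do not accumulate. -/
theorem sum_integral_bump_sq_le [IsFiniteMeasureOnCompacts μ] (hn : 0 < n) {ι : Type*} (d : ℕ)
    {K M N : ℝ} (hL : 0 < L) (hK : 0 < K) (hM : 0 < M) (hN : 0 < N) (S : Finset ι)
    (c : ι → EuclideanSpace ℝ (Fin n)) (D : ι → ℝ) (j : ι → ℤ)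
    (h : ι → EuclideanSpace ℝ (Fin n) → ℝ)
    (hh : ∀ i ∈ S, IsMeanZeroBump μ L (c i) (D i) (h i))
    (hD0 : ∀ i ∈ S, 0 < D i) (hD : ∀ i ∈ S, D i ≤ K * (2 : ℝ) ^ j i)
    (hball : ∀ i ∈ S, μ.real (ball (c i) (3 * D i)) ≤ M * (3 * D i) ^ d)
    (hcount : ∀ i ∈ S, ∀ k : ℤ,
      ((S.filter fun q => j q = k ∧ dist (c i) (c q) ≤ 3 * K * ((2 : ℝ) ^ j i + 2 ^ k)).card : ℝ)
        ≤ N * max 1 ((2 : ℝ) ^ j i / 2 ^ k) ^ d)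
    {g : EuclideanSpace ℝ (Fin n) → ℝ} (hg : MemLp g 2 μ) :
    ∑ i ∈ S, (((2 : ℝ) ^ j i) ^ (d + 2))⁻¹ * (∫ x, h i x * g x ∂μ) ^ 2
      ≤ 4 * N * (18 * L ^ 2 * M * 3 ^ d * K ^ (d + 2)) * ∫ x, g x ^ 2 ∂μ := by
  classical
  set B : ℝ := 18 * L ^ 2 * M * 3 ^ d * K ^ (d + 2) with hB
  have hB0 : 0 < B := by positivity
  have inner_eq : ∀ (f₁ f₂ : EuclideanSpace ℝ (Fin n) → ℝ) (h₁ : MemLp f₁ 2 μ)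
      (h₂ : MemLp f₂ 2 μ), inner ℝ (h₁.toLp f₁) (h₂.toLp f₂) = ∫ x, f₁ x * f₂ x ∂μ := by
    intro f₁ f₂ h₁ h₂
    rw [L2.inner_def]
    refine integral_congr_ae ?_
    filter_upwards [h₁.coeFn_toLp, h₂.coeFn_toLp] with x hx₁ hx₂
    rw [hx₁, hx₂]
    simp [mul_comm]
  have hG1 : ∀ p ∈ S, ∀ q ∈ S, |∫ x, h p x * h q x ∂μ| ≤ B * ((2 : ℝ) ^ j p) ^ (d + 2) := by
    intro p hp q hq
    have hDp := hD0 p hp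
    refine ((hh p hp).abs_integral_mul_le hn hL.le hDp.le (hh q hq)).trans ?_
    calc 18 * L ^ 2 * D p ^ 2 * μ.real (ball (c p) (3 * D p))
        ≤ 18 * L ^ 2 * D p ^ 2 * (M * (3 * D p) ^ d) :=
          mul_le_mul_of_nonneg_left (hball p hp) (by positivity)
      _ = 18 * L ^ 2 * M * 3 ^ d * D p ^ (d + 2) := by rw [mul_pow]; ring
      _ ≤ 18 * L ^ 2 * M * 3 ^ d * (K * (2 : ℝ) ^ j p) ^ (d + 2) := by
          gcongr; exact hD p hp
      _ = B * ((2 : ℝ) ^ j p) ^ (d + 2) := by rw [hB, mul_pow]; ring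
  let v : ι → Lp ℝ 2 μ := fun i => if hi : i ∈ S then (hh i hi).memLp.toLp (h i) else 0
  have hv : ∀ i (hi : i ∈ S), v i = (hh i hi).memLp.toLp (h i) := fun i hi => by simp [v, hi]
  -- With a Schur weight `s ^ β`, the sum over smaller scales converges for `β > d` and the sum over
  -- larger ones for `β < d + 2`. The midpoint `d + 1` gives the same decay `2 ^ (-|j i - k|)` on
  -- both sides.
  have key := sum_mul_inner_sq_le_of_schur S v (fun i => (((2 : ℝ) ^ j i) ^ (d + 2))⁻¹)
    (fun i => ((2 : ℝ) ^ j i) ^ (d + 1)) (fun i _ => by positivity) (fun i _ => by positivity)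
    (A := 4 * N * B) (by positivity) ?_ (hg.toLp g)
  · rw [← real_inner_self_eq_norm_sq, inner_eq] at key
    calc _ = ∑ i ∈ S, (((2 : ℝ) ^ j i) ^ (d + 2))⁻¹ * (inner ℝ (v i) (hg.toLp g)) ^ 2 :=
          Finset.sum_congr rfl fun i hi => by rw [hv i hi, inner_eq]
      _ ≤ _ := key
      _ = _ := by simp only [sq]
  · intro i hi
    have hsi : (0 : ℝ) < 2 ^ j i := by positivity
    rw [← Finset.sum_fiberwise_of_maps_to (g := j) (t := S.image j)
      (fun q hq => Finset.mem_image_of_mem j hq)]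
    have fiber : ∀ k ∈ S.image j, ∑ q ∈ S with j q = k, (((2 : ℝ) ^ j q) ^ (d + 2))⁻¹ *
        |inner ℝ (v i) (v q)| * ((2 : ℝ) ^ j q) ^ (d + 1)
        ≤ N * B * ((2 : ℝ) ^ j i) ^ (d + 1) * (1 / 2) ^ (j i - k).natAbs := by
      intro k _
      have hk : (0 : ℝ) < 2 ^ k := by positivity
      set m : ℝ := min ((2 : ℝ) ^ j i) (2 ^ k) with hm
      have hm0 : 0 < m := lt_min hsi hk
      have term : ∀ q ∈ S.filter (fun q => j q = k), (((2 : ℝ) ^ j q) ^ (d + 2))⁻¹ *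
          |inner ℝ (v i) (v q)| * ((2 : ℝ) ^ j q) ^ (d + 1) ≤
          if dist (c i) (c q) ≤ 3 * K * ((2 : ℝ) ^ j i + 2 ^ k) then
            ((2 : ℝ) ^ k)⁻¹ * (B * m ^ (d + 2)) else 0 := by
        intro q hq
        obtain ⟨hqS, hqk⟩ := Finset.mem_filter.1 hq
        rw [hv i hi, hv q hqS, inner_eq, hqk]
        have e : (((2 : ℝ) ^ k) ^ (d + 2))⁻¹ * |∫ x, h i x * h q x ∂μ| * ((2 : ℝ) ^ k) ^ (d + 1)
            = ((2 : ℝ) ^ k)⁻¹ * |∫ x, h i x * h q x ∂μ| := by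
          rw [pow_succ ((2 : ℝ) ^ k) (d + 1)]
          field_simp
        rw [e]
        split_ifs with hdist
        · refine mul_le_mul_of_nonneg_left ?_ (by positivity)
          rcases min_choice ((2 : ℝ) ^ j i) (2 ^ k) with h' | h'
          · rw [hm, h']; exact hG1 i hi q hqS
          · rw [hm, h', ← hqk]
            simp only [mul_comm (h i _)]
            exact hG1 q hqS i hi
        · rw [(hh i hi).integral_mul_eq_zero (hh q hqS), abs_zero, mul_zero]
          have h1 := hD i hi
          have h2 := hD q hqS
          rw [hqk] at h2
          push Not at hdist
          nlinarith
      refine (Finset.sum_le_sum term).trans ?_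
      rw [← Finset.sum_filter, Finset.filter_filter, Finset.sum_const, nsmul_eq_mul]
      refine (mul_le_mul_of_nonneg_right (hcount i hi k) (by positivity)).trans (le_of_eq ?_)
      rcases le_total (j i) k with hle | hle
      · obtain ⟨t, ht⟩ := Int.le.dest hle
        have e1 : (2 : ℝ) ^ k = 2 ^ j i * 2 ^ t := by
          rw [← ht, zpow_add₀ two_ne_zero, zpow_natCast]
        have e2 : (j i - k).natAbs = t := by omega
        have h2t : (1 : ℝ) ≤ 2 ^ t := one_le_pow₀ one_le_two
        have e3 : m = 2 ^ j i := min_eq_left (by rw [e1]; nlinarith)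
        have e4 : max (1 : ℝ) (2 ^ j i / 2 ^ k) = 1 := max_eq_left (by
          rw [div_le_one hk, e1]; nlinarith)
        rw [e3, e4, e2, e1, one_div, inv_pow, pow_succ ((2 : ℝ) ^ j i) (d + 1)]
        field_simp
        simp
      · obtain ⟨t, ht⟩ := Int.le.dest hle
        have e1 : (2 : ℝ) ^ j i = 2 ^ k * 2 ^ t := by
          rw [← ht, zpow_add₀ two_ne_zero, zpow_natCast]
        have e2 : (j i - k).natAbs = t := by omega
        have h2t : (1 : ℝ) ≤ 2 ^ t := one_le_pow₀ one_le_two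
        have e3 : m = 2 ^ k := min_eq_right (by rw [e1]; nlinarith)
        have e4 : max (1 : ℝ) (2 ^ j i / 2 ^ k) = 2 ^ t := by
          rw [e1, mul_div_cancel_left₀ _ hk.ne']; exact max_eq_right h2t
        rw [e3, e4, e2, e1, one_div, inv_pow, mul_pow, pow_succ ((2 : ℝ) ^ t) d,
          pow_succ ((2 : ℝ) ^ k) (d + 1)]
        field_simp
    refine (Finset.sum_le_sum fiber).trans ?_
    rw [← Finset.mul_sum]
    refine (mul_le_mul_of_nonneg_left (sum_half_pow_natAbs_sub_le _ _) (by positivity)).trans ?_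
    linarith
end

/-! ### Ahlfors regular measures. -/

section
variable {n d : ℕ} {μ : Measure (EuclideanSpace ℝ (Fin n))} {Cμ : ℝ}

/-- Regularity only concerns points of the support; every other point has a null neighbourhood. -/
theorem IsAhlforsRegular.isLocallyFiniteMeasure (hμ : IsAhlforsRegular d Cμ μ) :
    IsLocallyFiniteMeasure μ := by
  refine ⟨fun x => ?_⟩
  by_cases hx : x ∈ μ.support
  · exact ⟨ball x 1, ball_mem_nhds x one_pos,
      ((hμ x hx 1 one_pos).2).trans_lt ENNReal.ofReal_lt_top⟩
  · obtain ⟨U, hU, h0⟩ := Measure.notMem_support_iff_exists.1 hx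
    exact ⟨U, hU, by rw [h0]; exact ENNReal.zero_lt_top⟩

theorem IsAhlforsRegular.measureReal_ball_le (hμ : IsAhlforsRegular d Cμ μ) (hC : 0 < Cμ)
    {x : EuclideanSpace ℝ (Fin n)} (hx : x ∈ μ.support) {r : ℝ} (hr : 0 < r) :
    μ.real (ball x r) ≤ Cμ * r ^ d :=
  ENNReal.toReal_le_of_le_ofReal (by positivity) (hμ x hx r hr).2

theorem IsAhlforsRegular.le_measureReal_ball (hμ : IsAhlforsRegular d Cμ μ)
    {x : EuclideanSpace ℝ (Fin n)} (hx : x ∈ μ.support) {r : ℝ} (hr : 0 < r) :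
    Cμ⁻¹ * r ^ d ≤ μ.real (ball x r) :=
  (ENNReal.ofReal_le_iff_le_toReal
    (((hμ x hx r hr).2).trans_lt ENNReal.ofReal_lt_top).ne).1 (hμ x hx r hr).1

end

/-! ### Inner balls of dyadic cubes. -/

/-- The relative inner radius of the cubes of a dyadic system with constant `C`. -/
noncomputable def innerRadius (C : ℝ) : ℝ := (C⁻¹ * C⁻¹ / 2) ^ C

theorem innerRadius_pos {C : ℝ} (hC : 0 < C) : 0 < innerRadius C :=
  Real.rpow_pos_of_pos (by positivity) _

namespace IsDyadicSystem
variable {n d : ℕ} {E : Set (EuclideanSpace ℝ (Fin n))} {C : ℝ}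
  {Δ : ℤ → Set (Set (EuclideanSpace ℝ (Fin n)))} {j : ℤ} {Q : Set (EuclideanSpace ℝ (Fin n))}

theorem subset (hΔ : IsDyadicSystem d E C Δ) (hQ : Q ∈ Δ j) : Q ⊆ E :=
  (Set.subset_sUnion_of_mem hQ).trans (hΔ.sUnion_eq j).subset

theorem isBounded (hΔ : IsDyadicSystem d E C Δ) (hQ : Q ∈ Δ j) : Bornology.IsBounded Q :=
  isBounded_iff_ediam_ne_top.2 ((hΔ.ediam_le j Q hQ).trans_lt ENNReal.ofReal_lt_top).ne

theorem diam_le (hΔ : IsDyadicSystem d E C Δ) (hC : 0 < C) (hQ : Q ∈ Δ j) :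
    diam Q ≤ C * 2 ^ j :=
  ENNReal.toReal_le_of_le_ofReal (by positivity) (hΔ.ediam_le j Q hQ)

theorem le_diam (hΔ : IsDyadicSystem d E C Δ) (hQ : Q ∈ Δ j) : C⁻¹ * 2 ^ j ≤ diam Q :=
  (ENNReal.ofReal_le_iff_le_toReal
    ((hΔ.ediam_le j Q hQ).trans_lt ENNReal.ofReal_lt_top).ne).1 (hΔ.ediam_ge j Q hQ)

theorem diam_pos (hΔ : IsDyadicSystem d E C Δ) (hC : 0 < C) (hQ : Q ∈ Δ j) : 0 < diam Q :=
  lt_of_lt_of_le (by positivity) (hΔ.le_diam hQ)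

/-- Cubes have small boundaries, hence inner points. -/
theorem exists_ball_inter_subset (hΔ : IsDyadicSystem d E C Δ) (hC : 0 < C) (hQ : Q ∈ Δ j) :
    ∃ x ∈ Q, ball x (innerRadius C * 2 ^ j) ∩ E ⊆ Q := by
  by_contra hcon
  have hτ := innerRadius_pos hC
  -- Without an inner point the whole cube is boundary layer. The inner radius is chosen so that the
  -- layer has Hausdorff measure at most `C⁻¹ / 2 * 2 ^ (j * d)`, half the lower bound for the cube.
  have hall : {x ∈ Q | infEDist x (E \ Q) ≤ ENNReal.ofReal (innerRadius C * (2 : ℝ) ^ j)} = Q := by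
    refine Set.Subset.antisymm (fun x hx => hx.1) fun x hx => ⟨hx, ?_⟩
    have hnot : ¬ ball x (innerRadius C * 2 ^ j) ∩ E ⊆ Q := fun hsub => hcon ⟨x, hx, hsub⟩
    obtain ⟨y, ⟨hyb, hyE⟩, hyQ⟩ := Set.not_subset.1 hnot
    refine (infEDist_le_edist_of_mem (show y ∈ E \ Q from ⟨hyE, hyQ⟩)).trans ?_
    rw [edist_dist, dist_comm]
    exact ENNReal.ofReal_le_ofReal (le_of_lt hyb)
  have h1 := hΔ.boundary_le j Q hQ _ hτ
  rw [hall] at h1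
  have h2 := (hΔ.measure_ge j Q hQ).trans h1
  have e : innerRadius C ^ (1 / C) = C⁻¹ * C⁻¹ / 2 := by
    rw [innerRadius, ← Real.rpow_mul (by positivity), mul_one_div_cancel hC.ne', Real.rpow_one]
  have hp : (0 : ℝ) < 2 ^ (j * d) := by positivity
  rw [e, ENNReal.ofReal_le_ofReal_iff (by positivity)] at h2
  have e2 : C * (C⁻¹ * C⁻¹ / 2) = C⁻¹ / 2 := by field_simp
  rw [e2] at h2
  have : 0 < C⁻¹ := by positivity
  nlinarith [mul_pos this hp]

end IsDyadicSystem

/-! ### Measure and packing of cubes. -/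

section
variable {n d : ℕ} {μ : Measure (EuclideanSpace ℝ (Fin n))} {Cμ CD : ℝ}
  {Δ : ℤ → Set (Set (EuclideanSpace ℝ (Fin n)))}

theorem IsDyadicSystem.le_measure (hΔ : IsDyadicSystem d μ.support CD Δ) (hCD : 0 < CD)
    (hμ : IsAhlforsRegular d Cμ μ) {j : ℤ} {Q : Set (EuclideanSpace ℝ (Fin n))} (hQ : Q ∈ Δ j) :
    ENNReal.ofReal (Cμ⁻¹ * (innerRadius CD * 2 ^ j) ^ d) ≤ μ Q := by
  obtain ⟨x, hxQ, hx⟩ := hΔ.exists_ball_inter_subset hCD hQ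
  have hτ := innerRadius_pos hCD
  refine ((hμ x (hΔ.subset hQ hxQ) _ (by positivity)).1).trans ?_
  rw [← measure_inter_conull (t := μ.support) (by simp)]
  exact measure_mono hx

/-- The number of cubes of one generation near a given point. -/
theorem IsDyadicSystem.card_le (hΔ : IsDyadicSystem d μ.support CD Δ) (hCμ : 0 < Cμ)
    (hCD : 0 < CD) (hμ : IsAhlforsRegular d Cμ μ) {ι : Type*} (F : Finset ι) (k : ℤ)
    (Q : ι → Set (EuclideanSpace ℝ (Fin n))) (hinj : Function.Injective Q)
    (hQ : ∀ q ∈ F, Q q ∈ Δ k) (c : ι → EuclideanSpace ℝ (Fin n)) (hc : ∀ q ∈ F, c q ∈ Q q)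
    {y : EuclideanSpace ℝ (Fin n)} (hy : y ∈ μ.support) {R : ℝ} (hR : 0 < R)
    (hyc : ∀ q ∈ F, dist y (c q) ≤ R) :
    (F.card : ℝ) ≤
      Cμ ^ 2 * ((R + CD * 2 ^ k + innerRadius CD * 2 ^ k) / (innerRadius CD * 2 ^ k)) ^ d := by
  classical
  have := hμ.isLocallyFiniteMeasure
  have hτ := innerRadius_pos hCD
  set t := innerRadius CD * 2 ^ k with ht
  have ht0 : 0 < t := by positivity
  set R' := R + CD * 2 ^ k + t with hR'
  have hR0 : 0 < R' := by positivity
  have hex : ∀ q, ∃ x, q ∈ F → x ∈ Q q ∧ ball x t ∩ μ.support ⊆ Q q := fun q => by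
    by_cases hq : q ∈ F
    · obtain ⟨x, h1, h2⟩ := hΔ.exists_ball_inter_subset hCD (hQ q hq)
      exact ⟨x, fun _ => ⟨h1, h2⟩⟩
    · exact ⟨0, fun h => absurd h hq⟩
  choose x hx using hex
  have hsub : ∀ q ∈ F, ball (x q) t ∩ μ.support ⊆ ball y R' := by
    intro q hq
    refine Set.inter_subset_left.trans (ball_subset_ball' ?_)
    have h1 : dist (x q) (c q) ≤ diam (Q q) :=
      dist_le_diam_of_mem (hΔ.isBounded (hQ q hq)) (hx q hq).1 (hc q hq)
    have h2 := hΔ.diam_le hCD (hQ q hq)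
    have h3 := hyc q hq
    have h4 := dist_triangle_right (x q) y (c q)
    linarith
  -- The volume count uses inner balls cut with the support, which are measurable; the cubes are not
  -- assumed to be. The inner points `x q` are unrelated to the arbitrary centers `c q`, which enter
  -- only through distances.
  have hdisj : (F : Set ι).PairwiseDisjoint fun q => ball (x q) t ∩ μ.support := by
    intro p hp q hq hpq
    have h1 : Disjoint (Q p) (Q q) :=
      hΔ.disjoint k (hQ p hp) (hQ q hq) fun h => hpq (hinj h)
    exact h1.mono (hx p hp).2 (hx q hq).2
  have hmeas : ∀ q ∈ F, MeasurableSet (ball (x q) t ∩ μ.support) := fun q _ =>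
    measurableSet_ball.inter Measure.isClosed_support.measurableSet
  have h1 : ∑ q ∈ F, μ.real (ball (x q) t ∩ μ.support) ≤ μ.real (ball y R') := by
    rw [← measureReal_biUnion_finset hdisj hmeas
      (fun q _ => (measure_mono Set.inter_subset_left |>.trans_lt measure_ball_lt_top).ne)]
    exact measureReal_mono (Set.iUnion₂_subset hsub) measure_ball_lt_top.ne
  have h2 : ∀ q ∈ F, Cμ⁻¹ * t ^ d ≤ μ.real (ball (x q) t ∩ μ.support) := by
    intro q hq
    rw [measureReal_def, measure_inter_conull (by simp)]
    exact hμ.le_measureReal_ball (hΔ.subset (hQ q hq) (hx q hq).1) ht0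
  have h3 := (Finset.sum_le_sum h2).trans (h1.trans (hμ.measureReal_ball_le hCμ hy hR0))
  rw [Finset.sum_const, nsmul_eq_mul] at h3
  rw [div_pow, ← mul_div_assoc, le_div_iff₀ (by positivity)]
  calc (F.card : ℝ) * t ^ d = Cμ * (F.card * (Cμ⁻¹ * t ^ d)) := by field_simp
    _ ≤ Cμ * (Cμ * R' ^ d) := mul_le_mul_of_nonneg_left h3 hCμ.le
    _ = Cμ ^ 2 * R' ^ d := by ring

/-! ### From oscillation coefficients to mean-zero bumps. -/

theorem IsL2Loc.locallyIntegrable [IsFiniteMeasureOnCompacts μ]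
    {g : EuclideanSpace ℝ (Fin n) → ℝ} (hg : IsL2Loc μ g) : LocallyIntegrable g μ := by
  refine locallyIntegrable_iff.2 fun K hK => ?_
  have : IsFiniteMeasure (μ.restrict K) := ⟨by simpa using hK.measure_lt_top⟩
  exact (hg K hK).integrable one_le_two

theorem IsMeanZeroBump.integrable_mul [IsFiniteMeasureOnCompacts μ] {L D : ℝ}
    {c : EuclideanSpace ℝ (Fin n)} {h g : EuclideanSpace ℝ (Fin n) → ℝ}
    (hh : IsMeanZeroBump μ L c D h) (hg : IsL2Loc μ g) : Integrable (fun x => h x * g x) μ := by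
  simpa using hg.locallyIntegrable.integrable_smul_left_of_hasCompactSupport hh.continuous
    hh.hasCompactSupport

/-- Subtracting a multiple of a fixed tent function gives a test function mean zero. -/
theorem exists_multiplier_of_lipTest (hn : 0 < n) (hCμ : 0 < Cμ) (hμ : IsAhlforsRegular d Cμ μ)
    {c : EuclideanSpace ℝ (Fin n)} (hc : c ∈ μ.support) {D : ℝ} (hD : 0 < D)
    {g : EuclideanSpace ℝ (Fin n) → ℝ} (hg : IsL2Loc μ g) :
    ∃ lam : ℝ, ∀ f ∈ lipTest (ball c (3 * D)), ∃ h,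
      IsMeanZeroBump μ (1 + 6 * 3 ^ d * Cμ ^ 2) c D h ∧
      ∫ x, (f x * g x - lam * f x) ∂μ = ∫ x, h x * g x ∂μ := by
  have := hμ.isLocallyFiniteMeasure
  set φ : EuclideanSpace ℝ (Fin n) → ℝ := fun x => max (2 * D - dist x c) 0 with hφ
  have φlip : ∀ x y, |φ x - φ y| ≤ 1 * dist x y := by
    intro x y
    refine (abs_max_sub_max_le_abs _ _ _).trans ?_
    have e : 2 * D - dist x c - (2 * D - dist y c) = dist y c - dist x c := by ring
    rw [e, one_mul, dist_comm x y]
    exact abs_dist_sub_le y x c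
  have φz : ∀ x ∉ ball c (3 * D), φ x = 0 := by
    intro x hx
    rw [mem_ball, not_lt] at hx
    exact max_eq_right (by linarith)
  have φ0 : ∀ x, 0 ≤ φ x := fun x => le_max_right _ _
  have int_of : ∀ {f : EuclideanSpace ℝ (Fin n) → ℝ},
      (∀ x y, |f x - f y| ≤ 1 * dist x y) → (∀ x ∉ ball c (3 * D), f x = 0) →
      Integrable f μ ∧ Integrable (fun x => f x * g x) μ := by
    intro f h1 h2
    refine ⟨(continuous_of_abs_sub_le h1).integrable_of_hasCompactSupport
      (hasCompactSupport_of_eq_zero_off_ball h2), ?_⟩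
    simpa using hg.locallyIntegrable.integrable_smul_left_of_hasCompactSupport
      (continuous_of_abs_sub_le h1) (hasCompactSupport_of_eq_zero_off_ball h2)
  obtain ⟨φi, φgi⟩ := int_of φlip φz
  set I := ∫ x, φ x ∂μ with hI
  have hIge : D * (Cμ⁻¹ * D ^ d) ≤ I := by
    calc D * (Cμ⁻¹ * D ^ d) ≤ D * μ.real (ball c D) :=
          mul_le_mul_of_nonneg_left (hμ.le_measureReal_ball hc hD) hD.le
      _ = ∫ x in ball c D, D ∂μ := by rw [setIntegral_const, smul_eq_mul, mul_comm]
      _ ≤ ∫ x in ball c D, φ x ∂μ := by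
          refine setIntegral_mono_on (integrableOn_const measure_ball_lt_top.ne) φi.integrableOn
            measurableSet_ball fun x hx => ?_
          have : dist x c < D := hx
          exact le_max_of_le_left (by linarith)
      _ ≤ I := setIntegral_le_integral φi (Filter.Eventually.of_forall φ0)
  have hI0 : 0 < I := lt_of_lt_of_le (by positivity) hIge
  -- With `κ = ∫ f / ∫ φ`, the bump `f - κ φ` has mean zero, and `κ ∫ φ g = lam ∫ f` for this `lam`,
  -- which does not depend on `f`.
  refine ⟨(∫ x, φ x * g x ∂μ) / I, fun f hf => ?_⟩
  obtain ⟨flip, -, fsupp⟩ := hf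
  have flip' : ∀ x y, |f x - f y| ≤ 1 * dist x y := fun x y => by
    have := flip.dist_le_mul x y
    rwa [Real.dist_eq] at this
  have fz : ∀ x ∉ ball c (3 * D), f x = 0 := fun x hx =>
    image_eq_zero_of_notMem_tsupport fun h => hx (fsupp h)
  obtain ⟨fi, fgi⟩ := int_of flip' fz
  set κ := (∫ x, f x ∂μ) / I with hκ
  -- Here `|f| ≤ 6D` on a ball of radius `3D`, while `φ ≥ D` on the ball of radius `D`; regularity
  -- compares the two measures, and the powers of `D` cancel.
  have hκle : |κ| ≤ 6 * 3 ^ d * Cμ ^ 2 := by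
    have h1 : |∫ x, f x ∂μ| ≤ 6 * D * (Cμ * (3 * D) ^ d) := by
      rw [← setIntegral_eq_integral_of_forall_compl_eq_zero (s := ball c (3 * D)) fz,
        ← Real.norm_eq_abs]
      refine (norm_setIntegral_le_of_norm_le_const (C := 6 * D) measure_ball_lt_top
        fun x _ => ?_).trans
        (mul_le_mul_of_nonneg_left (hμ.measureReal_ball_le hCμ hc (by positivity)) (by positivity))
      simpa using abs_le_of_lip_of_eq_zero_off_ball hn zero_le_one hD.le flip' fz x
    rw [hκ, abs_div, abs_of_pos hI0, div_le_iff₀ hI0]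
    calc |∫ x, f x ∂μ| ≤ 6 * D * (Cμ * (3 * D) ^ d) := h1
      _ = 6 * 3 ^ d * Cμ ^ 2 * (D * (Cμ⁻¹ * D ^ d)) := by rw [mul_pow]; field_simp
      _ ≤ _ := mul_le_mul_of_nonneg_left hIge (by positivity)
  refine ⟨fun x => f x - κ * φ x, ⟨fun x y => ?_, fun x hx => by simp [fz x hx, φz x hx], ?_⟩, ?_⟩
  · have e : f x - κ * φ x - (f y - κ * φ y) = (f x - f y) - κ * (φ x - φ y) := by ring
    rw [e]
    refine (abs_sub _ _).trans ?_
    rw [abs_mul]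
    have h1 := flip' x y
    have h2 := mul_le_mul hκle (φlip x y) (abs_nonneg _) (by positivity)
    linarith
  · rw [integral_sub fi (φi.const_mul κ), integral_const_mul, hκ]
    field_simp
    simp [hI]
  · have e : (fun x => (f x - κ * φ x) * g x) = fun x => f x * g x - κ * (φ x * g x) := by
      ext x; ring
    rw [e, integral_sub fgi (φgi.const_mul κ), integral_sub fgi (fi.const_mul _),
      integral_const_mul, integral_const_mul, hκ]
    ring

/-- The oscillation coefficient is realized, up to a factor `2`, by one mean-zero bump. -/
theorem exists_bump_oscCoeff_le (hn : 0 < n) (hCμ : 0 < Cμ) (hμ : IsAhlforsRegular d Cμ μ)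
    {c : EuclideanSpace ℝ (Fin n)} (hc : c ∈ μ.support) {Q : Set (EuclideanSpace ℝ (Fin n))}
    (hD : 0 < diam Q) {g : EuclideanSpace ℝ (Fin n) → ℝ} (hg : IsL2Loc μ g) :
    ∃ h, IsMeanZeroBump μ (1 + 6 * 3 ^ d * Cμ ^ 2) c (diam Q) h ∧
      oscCoeff d μ g Q c ≤ ENNReal.ofReal (2 * (diam Q ^ (d + 1))⁻¹ * |∫ x, h x * g x ∂μ|) := by
  have := hμ.isLocallyFiniteMeasure
  obtain ⟨lam, hlam⟩ := exists_multiplier_of_lipTest hn hCμ hμ hc hD hg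
  set L := 1 + 6 * 3 ^ d * Cμ ^ 2 with hL
  have hL0 : 0 < L := by positivity
  set D := diam Q with hDdef
  set a : ℝ≥0∞ := ⨆ f ∈ lipTest (ball c (3 * D)),
    ENNReal.ofReal |∫ x, (f x * g x - lam * f x) ∂μ| with ha
  have hosc : oscCoeff d μ g Q c ≤ (ENNReal.ofReal (D ^ (d + 1)))⁻¹ * a :=
    mul_le_mul_right (iInf_le _ lam) _
  suffices ∃ h, IsMeanZeroBump μ L c D h ∧ a ≤ ENNReal.ofReal (2 * |∫ x, h x * g x ∂μ|) by
    obtain ⟨h, hh, hle⟩ := this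
    refine ⟨h, hh, hosc.trans ((mul_le_mul_right hle _).trans (le_of_eq ?_))⟩
    rw [← ENNReal.ofReal_inv_of_pos (by positivity), ← ENNReal.ofReal_mul (by positivity)]
    congr 1; ring
  -- The supremum need not be attained, but once finite and nonzero it strictly exceeds its half, so
  -- some test function achieves at least half of it.
  have hatop : a ≠ ∞ := by
    have hle : a ≤ ENNReal.ofReal (∫ x in ball c (3 * D), 6 * L * D * |g x| ∂μ) := by
      refine iSup₂_le fun f hf => ENNReal.ofReal_le_ofReal ?_
      obtain ⟨h, hh, heq⟩ := hlam f hf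
      rw [heq, ← setIntegral_eq_integral_of_forall_compl_eq_zero (s := ball c (3 * D))
        (fun x hx => by rw [hh.zero x hx, zero_mul])]
      refine abs_integral_le_integral_abs.trans ?_
      have hgi : IntegrableOn g (ball c (3 * D)) μ :=
        (hg.locallyIntegrable.integrableOn_isCompact (isCompact_closedBall c (3 * D))).mono_set
          ball_subset_closedBall
      refine integral_mono (hh.integrable_mul hg).integrableOn.abs (hgi.abs.const_mul _) fun x => ?_
      simp only [abs_mul]
      exact mul_le_mul_of_nonneg_right
        (abs_le_of_lip_of_eq_zero_off_ball hn hL0.le hD.le hh.lip hh.zero x) (abs_nonneg _)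
    exact (hle.trans_lt ENNReal.ofReal_lt_top).ne
  rcases eq_or_ne a 0 with h0 | h0
  · refine ⟨fun _ => 0, ⟨fun x y => ?_, fun _ _ => rfl, by simp⟩, by rw [h0]; exact zero_le⟩
    rw [sub_zero, abs_zero]; positivity
  · obtain ⟨f, hf, hlt⟩ := lt_biSup_iff.1 ((ENNReal.half_lt_self h0 hatop).trans_eq ha)
    obtain ⟨h, hh, heq⟩ := hlam f hf
    refine ⟨h, hh, ?_⟩
    rw [heq] at hlt
    rw [ENNReal.ofReal_mul zero_le_two, ENNReal.ofReal_ofNat, mul_comm]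
    exact (ENNReal.div_le_iff two_ne_zero ENNReal.ofNat_ne_top).1 hlt.le

end

/-! ### The square function estimate. -/

section
variable {n d : ℕ} {μ : Measure (EuclideanSpace ℝ (Fin n))} {Cμ CD : ℝ}
  {Δ : ℤ → Set (Set (EuclideanSpace ℝ (Fin n)))}

/-- Compactness makes `g` square integrable on the dilate; the enclosing ball bounds the measure of
the dilate by regularity. -/
theorem isCompact_dilate {R : Set (EuclideanSpace ℝ (Fin n))} (lam : ℝ)
    (hR : Bornology.IsBounded R) {c : EuclideanSpace ℝ (Fin n)} (hc : c ∈ R) :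
    IsCompact (dilate μ.support lam R) ∧
      dilate μ.support lam R ⊆ closedBall c (lam * diam R) := by
  have hsub : dilate μ.support lam R ⊆ closedBall c (lam * diam R) := by
    intro x hx
    have h1 := dist_le_infDist_add_diam hR hc (x := x)
    have h2 := hx.2
    rw [mem_closedBall]; linarith
  refine ⟨isCompact_of_isClosed_isBounded ?_ (isBounded_closedBall.subset hsub), hsub⟩
  exact Measure.isClosed_support.inter
    (isClosed_le (continuous_infDist_pt R) continuous_const)

/-- The constant in the square function estimate for oscillation coefficients. -/
noncomputable def oscConst (d : ℕ) (Cμ CD : ℝ) : ℝ :=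
  4 * Cμ * 2 ^ d * CD ^ (d + 2) *
    (4 * (Cμ ^ 2 * ((7 * CD + innerRadius CD) / innerRadius CD) ^ d) *
      (18 * (1 + 6 * 3 ^ d * Cμ ^ 2) ^ 2 * Cμ * 3 ^ d * CD ^ (d + 2)))

theorem oscConst_pos (hCμ : 0 < Cμ) (hCD : 0 < CD) : 0 < oscConst d Cμ CD := by
  have := innerRadius_pos hCD
  unfold oscConst; positivity

/-- The square function estimate, before normalization. -/
theorem tsum_oscCoeff_sq_mul_le (hn : 0 < n) (hCμ : 0 < Cμ) (hCD : 0 < CD)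
    (hμ : IsAhlforsRegular d Cμ μ) (hΔ : IsDyadicSystem d μ.support CD Δ)
    {c : Set (EuclideanSpace ℝ (Fin n)) → EuclideanSpace ℝ (Fin n)}
    (hc : ∀ Q ∈ allCubes Δ, c Q ∈ Q) {g : EuclideanSpace ℝ (Fin n) → ℝ} (hg : IsL2Loc μ g)
    {R : Set (EuclideanSpace ℝ (Fin n))} (hR : R ∈ allCubes Δ) (m : ℝ) :
    ∑' Q : cubesIn Δ R, oscCoeff d μ g (Q : Set (EuclideanSpace ℝ (Fin n))) (c Q) ^ 2 * μ Q
      ≤ ENNReal.ofReal (oscConst d Cμ CD * ∫ x in dilate μ.support 4 R, (g x - m) ^ 2 ∂μ) := by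
  classical
  have := hμ.isLocallyFiniteMeasure
  have hτ := innerRadius_pos hCD
  set τ := innerRadius CD with hτdef
  obtain ⟨j₀, hRj⟩ := Set.mem_iUnion.1 hR
  have hRb := hΔ.isBounded hRj
  set Ω := dilate μ.support 4 R with hΩ
  have hΩc : IsCompact Ω := (isCompact_dilate 4 hRb (hc R hR)).1
  have hΩm : MeasurableSet Ω := hΩc.isClosed.measurableSet
  have : IsFiniteMeasure (μ.restrict Ω) := ⟨by simpa using hΩc.measure_lt_top⟩
  set g' : EuclideanSpace ℝ (Fin n) → ℝ := Ω.indicator fun x => g x - m with hg'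
  have hg'L : MemLp g' 2 μ :=
    (memLp_indicator_iff_restrict hΩm).2 ((hg Ω hΩc).sub (memLp_const m))
  have hg'int : ∫ x, g' x ^ 2 ∂μ = ∫ x in Ω, (g x - m) ^ 2 ∂μ := by
    rw [← integral_indicator hΩm]
    refine integral_congr_ae (Filter.Eventually.of_forall fun x => ?_)
    by_cases hx : x ∈ Ω <;> simp [hg', hx]
  rw [ENNReal.tsum_eq_iSup_sum]
  refine iSup_le fun S => ?_
  -- The same set may belong to several generations. The sum counts it once, and any one generation
  -- serves as its scale.
  have hj : ∀ Q : cubesIn Δ R, ∃ j, (Q : Set (EuclideanSpace ℝ (Fin n))) ∈ Δ j := fun Q =>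
    Set.mem_iUnion.1 Q.2.1
  choose j hj using hj
  have hcQ : ∀ Q : cubesIn Δ R, c Q ∈ (Q : Set (EuclideanSpace ℝ (Fin n))) := fun Q => hc Q Q.2.1
  have hcE : ∀ Q : cubesIn Δ R, c Q ∈ μ.support := fun Q => hΔ.subset (hj Q) (hcQ Q)
  have hD0 : ∀ Q : cubesIn Δ R, 0 < diam (Q : Set (EuclideanSpace ℝ (Fin n))) := fun Q =>
    hΔ.diam_pos hCD (hj Q)
  have hbump := fun Q : cubesIn Δ R => exists_bump_oscCoeff_le hn hCμ hμ (hcE Q) (hD0 Q) hg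
  choose h hh hosc using hbump
  -- Points of the support in `B(c Q, 3 diam Q)` are within `3 diam R` of `R`, hence in `4R`: this
  -- is where the dilation factor 4 comes from. The constant `m` drops out since `h Q` has mean
  -- zero.
  have hgg' : ∀ Q : cubesIn Δ R, ∫ x, h Q x * g x ∂μ = ∫ x, h Q x * g' x ∂μ := by
    intro Q
    have e : ∫ x, h Q x * g' x ∂μ = ∫ x, (h Q x * g x - h Q x * m) ∂μ := by
      refine integral_congr_ae ?_
      filter_upwards [Measure.support_mem_ae (μ := μ)] with x hx
      by_cases hxb : x ∈ ball (c Q) (3 * diam (Q : Set (EuclideanSpace ℝ (Fin n))))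
      · have hxΩ : x ∈ Ω := by
          refine ⟨hx, (infDist_le_dist_of_mem (Q.2.2 (hcQ Q))).trans ((le_of_lt hxb).trans ?_)⟩
          have := diam_mono Q.2.2 hRb
          linarith
        simp only [hg', Set.indicator_of_mem hxΩ]; ring
      · simp [(hh Q).zero x hxb]
    rw [e, integral_sub ((hh Q).integrable_mul hg) ((hh Q).integrable.mul_const m),
      integral_mul_const, (hh Q).mean, zero_mul, sub_zero]
  -- The squared normalization `D ^ (-2 * (d + 1))` times `μ Q ≲ D ^ d` leaves the Bessel weight `D
  -- ^ (-(d + 2))`.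
  have hterm : ∀ Q ∈ S, oscCoeff d μ g (Q : Set (EuclideanSpace ℝ (Fin n))) (c Q) ^ 2 * μ Q ≤
      ENNReal.ofReal (4 * Cμ * 2 ^ d * CD ^ (d + 2) *
        ((((2 : ℝ) ^ j Q) ^ (d + 2))⁻¹ * (∫ x, h Q x * g' x ∂μ) ^ 2)) := by
    intro Q _
    have hD := hD0 Q
    set D := diam (Q : Set (EuclideanSpace ℝ (Fin n))) with hDdef
    have hμQ : μ Q ≤ ENNReal.ofReal (Cμ * (2 * D) ^ d) := by
      refine (measure_mono fun x hx => ?_).trans (hμ _ (hcE Q) (2 * D) (by positivity)).2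
      have := dist_le_diam_of_mem (hΔ.isBounded (hj Q)) hx (hcQ Q)
      rw [mem_ball]; linarith
    have h1 := hosc Q
    rw [hgg' Q] at h1
    refine (mul_le_mul' (pow_le_pow_left₀ zero_le h1 2) hμQ).trans ?_
    rw [← ENNReal.ofReal_pow (by positivity), ← ENNReal.ofReal_mul (by positivity)]
    refine ENNReal.ofReal_le_ofReal ?_
    set X := ∫ x, h Q x * g' x ∂μ with hX
    have hDs : (D ^ (d + 2))⁻¹ ≤ CD ^ (d + 2) * (((2 : ℝ) ^ j Q) ^ (d + 2))⁻¹ := by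
      have h2 : CD⁻¹ * (2 : ℝ) ^ j Q ≤ D := hΔ.le_diam (hj Q)
      calc (D ^ (d + 2))⁻¹ ≤ ((CD⁻¹ * (2 : ℝ) ^ j Q) ^ (d + 2))⁻¹ := by gcongr
        _ = _ := by rw [mul_pow, mul_inv, inv_pow, inv_inv]
    calc (2 * (D ^ (d + 1))⁻¹ * |X|) ^ 2 * (Cμ * (2 * D) ^ d)
        = 4 * Cμ * 2 ^ d * (D ^ (d + 2))⁻¹ * X ^ 2 := by
          rw [mul_pow, mul_pow, sq_abs, mul_pow]
          field_simp
          ring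
      _ ≤ 4 * Cμ * 2 ^ d * (CD ^ (d + 2) * (((2 : ℝ) ^ j Q) ^ (d + 2))⁻¹) * X ^ 2 := by gcongr
      _ = _ := by ring
  refine (Finset.sum_le_sum hterm).trans ?_
  rw [← ENNReal.ofReal_sum_of_nonneg (fun Q _ => by positivity), ← Finset.mul_sum, ← hg'int]
  refine ENNReal.ofReal_le_ofReal ?_
  rw [oscConst, mul_assoc _ _ (∫ x, g' x ^ 2 ∂μ)]
  refine mul_le_mul_of_nonneg_left ?_ (by positivity)
  refine sum_integral_bump_sq_le hn d (by positivity) hCD hCμ (by positivity) S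
    (fun Q => c Q) (fun Q => diam (Q : Set (EuclideanSpace ℝ (Fin n)))) j h
    (fun Q _ => hh Q) (fun Q _ => hD0 Q) (fun Q _ => hΔ.diam_le hCD (hj Q))
    (fun Q _ => hμ.measureReal_ball_le hCμ (hcE Q) (mul_pos three_pos (hD0 Q))) ?_ hg'L
  intro P _ k
  have hk : (0 : ℝ) < 2 ^ k := by positivity
  have hP : (0 : ℝ) < 2 ^ j P := by positivity
  refine (hΔ.card_le hCμ hCD hμ _ k (fun Q : cubesIn Δ R => (Q : Set _)) Subtype.val_injective
    (fun q hq => ?_) (fun q => c q) (fun q _ => hcQ q) (hcE P)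
    (R := 3 * CD * ((2 : ℝ) ^ j P + 2 ^ k)) (by positivity) (fun q hq => ?_)).trans ?_
  · have := (Finset.mem_filter.1 hq).2.1
    exact this ▸ hj q
  · exact (Finset.mem_filter.1 hq).2.2
  · rw [mul_assoc (Cμ ^ 2), ← mul_pow]
    refine mul_le_mul_of_nonneg_left (pow_le_pow_left₀ (by positivity) ?_ d) (by positivity)
    rw [← hτdef, div_mul_eq_mul_div, div_le_div_iff₀ (by positivity) hτ]
    have h1 : (2 : ℝ) ^ k ≤ max 1 ((2 : ℝ) ^ j P / 2 ^ k) * 2 ^ k :=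
      le_mul_of_one_le_left hk.le (le_max_left _ _)
    have h2 : (2 : ℝ) ^ j P ≤ max 1 ((2 : ℝ) ^ j P / 2 ^ k) * 2 ^ k := by
      rw [← div_le_iff₀ hk]; exact le_max_right _ _
    -- `Y` dominates both scales, so the packing radius is at most `(3 + 3 + 1) * CD * Y + τ * Y`,
    -- whence the 7 in `oscConst`.
    set Y := max 1 ((2 : ℝ) ^ j P / 2 ^ k) * 2 ^ k with hY
    calc (3 * CD * ((2 : ℝ) ^ j P + 2 ^ k) + CD * 2 ^ k + τ * 2 ^ k) * τ
        ≤ (3 * CD * (Y + Y) + CD * Y + τ * Y) * τ := by gcongr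
      _ = _ := by rw [hY]; ring

end

/-! ### Normalization and conclusion. -/

/-- Carleson estimate for the oscillation coefficients. The point `c Q` is the center of the cube
`Q`; the estimate is claimed for an arbitrary choice of points `c Q ∈ Q`, in particular for centers
that stay at distance at least `CD⁻¹ * diam Q` from the other cubes of the same generation. -/
theorem mainTheorem9 (n d : ℕ) (hd : 0 < d) (hdn : d < n) (Cμ CD : ℝ) (hCμ : 0 < Cμ)
    (hCD : 0 < CD) :
    ∃ C C₀ : ℝ, 0 < C ∧ 1 < C₀ ∧
      ∀ μ : Measure (EuclideanSpace ℝ (Fin n)), IsAhlforsRegular d Cμ μ →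
      ∀ Δ : ℤ → Set (Set (EuclideanSpace ℝ (Fin n))), IsDyadicSystem d μ.support CD Δ →
      ∀ c : Set (EuclideanSpace ℝ (Fin n)) → EuclideanSpace ℝ (Fin n),
        (∀ Q ∈ allCubes Δ, c Q ∈ Q) →
      ∀ g : EuclideanSpace ℝ (Fin n) → ℝ, IsL2Loc μ g →
      ∀ R₀ ∈ allCubes Δ,
        (μ R₀)⁻¹ * ∑' Q : cubesIn Δ R₀,
            oscCoeff d μ g (Q : Set (EuclideanSpace ℝ (Fin n))) (c Q) ^ 2 * μ Q
          ≤ ENNReal.ofReal (C * ⨍ x in dilate μ.support C₀ R₀,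
              (g x - ⨍ y in dilate μ.support C₀ R₀, g y ∂μ) ^ 2 ∂μ) := by
  have hτ := innerRadius_pos hCD
  have hA := oscConst_pos (d := d) hCμ hCD
  set τ := innerRadius CD with hτdef
  refine ⟨oscConst d Cμ CD * (Cμ ^ 2 * (5 * CD / τ) ^ d), 4, by positivity, by norm_num, ?_⟩
  intro μ hμ Δ hΔ c hc g hg R hR
  have := hμ.isLocallyFiniteMeasure
  obtain ⟨j, hRj⟩ := Set.mem_iUnion.1 hR
  have hD := hΔ.diam_pos hCD hRj
  have hcE := hΔ.subset hRj (hc R hR)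
  set Ω := dilate μ.support 4 R with hΩ
  set m := ⨍ y in Ω, g y ∂μ with hm
  obtain ⟨hΩc, hΩsub⟩ := isCompact_dilate (μ := μ) 4 (hΔ.isBounded hRj) (hc R hR)
  set s : ℝ := 2 ^ j with hs
  have hs0 : 0 < s := by positivity
  have hlow : ENNReal.ofReal (Cμ⁻¹ * (τ * s) ^ d) ≤ μ R := hΔ.le_measure hCD hμ hRj
  -- The factor 5 passes from the closed ball of radius `4 diam R` to an open ball, where regularity
  -- applies.
  have hΩle : μ.real Ω ≤ Cμ * (5 * CD * s) ^ d := by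
    have h1 : Ω ⊆ ball (c R) (5 * diam R) :=
      hΩsub.trans (closedBall_subset_ball (by linarith))
    have h2 := (measureReal_mono h1 measure_ball_lt_top.ne).trans
      (hμ.measureReal_ball_le hCμ hcE (by positivity))
    refine h2.trans ?_
    have := hΔ.diam_le hCD hRj
    rw [mul_assoc 5 CD s]
    gcongr
  have hRΩ : R ⊆ Ω := fun x hx =>
    ⟨hΔ.subset hRj hx, by rw [infDist_zero_of_mem hx]; positivity⟩
  have hΩpos : 0 < μ.real Ω := by
    refine ENNReal.toReal_pos (ne_of_gt ?_) hΩc.measure_lt_top.ne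
    exact (ENNReal.ofReal_pos.2 (by positivity)).trans_le (hlow.trans (measure_mono hRΩ))
  refine (mul_le_mul' (ENNReal.inv_le_inv.2 hlow)
    (tsum_oscCoeff_sq_mul_le (by omega) hCμ hCD hμ hΔ hc hg hR m)).trans ?_
  rw [← ENNReal.ofReal_inv_of_pos (by positivity), ← ENNReal.ofReal_mul (by positivity),
    setAverage_eq, smul_eq_mul]
  refine ENNReal.ofReal_le_ofReal ?_
  set J := ∫ x in Ω, (g x - m) ^ 2 ∂μ with hJ
  have hJ0 : 0 ≤ J := integral_nonneg fun x => sq_nonneg _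
  -- The lower bound for `μ R` and the upper bound for `μ (4R)` are comparable, so normalizing by
  -- one or the other costs only a constant.
  have hinv : (Cμ⁻¹ * (τ * s) ^ d)⁻¹ ≤ Cμ ^ 2 * (5 * CD / τ) ^ d * (μ.real Ω)⁻¹ := by
    rw [← div_eq_mul_inv, le_div_iff₀ hΩpos]
    calc _ ≤ (Cμ⁻¹ * (τ * s) ^ d)⁻¹ * (Cμ * (5 * CD * s) ^ d) := by gcongr
      _ = _ := by
        rw [mul_pow, mul_pow (5 * CD), div_pow]
        field_simp
  calc _ ≤ Cμ ^ 2 * (5 * CD / τ) ^ d * (μ.real Ω)⁻¹ * (oscConst d Cμ CD * J) := by gcongr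
    _ = _ := by ring
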